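/- Let $N$ be a finite set of players. A local welfare function is a map $W:2^N\to\mathbb{R}$. A distribution rule is a map $f:N\times 2^N\to\mathbb{R}$ with $f(i,S)=0$ whenever $i\notin S$. Let $\mathbb{W}$ be any set of local welfare functions and $f^{\mathbb{W}}=\{f^W\}_{W\in\mathbb{W}}$ a family of distribution rules, one for each $W\in\mathbb{W}$ (not necessarily budget-balanced). The class $\mathcal{G}(N,f^{\mathbb{W}},\mathbb{W})$ consists of all welfare sharing games given by a finite set $R$ of at least two resources, a local welfare function $W_r\in\mathbb{W}$ for each $r\in R$, and a nonempty action set $\mathcal{A}_i\subseteq 2^R$ for each $i\in N$. The utility of player $i$ in the allocation $a=(a_i)_{i\in N}\in\prod_{i\in N}\mathcal{A}_i$ is $U_i(a)=\sum_{r\in a_i}f^{W_r}(i,\{a\}_r)$, where $\{a\}_r=\{j\in N: r\in a_j\}$. A pure Nash equilibrium is an allocation $a^*$ such that $U_i(a_i^*,a_{-i}^*)=\max_{a_i\in\mathcal{A}_i}U_i(a_i,a_{-i}^*)$ for every $i\in N$. A weight system $\omega=(\lambda,\Sigma)$ consists of weights $\lambda_i>0$ $(i\in N)$ and an ordered partition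 $\Sigma=(S_1,\dots,S_m)$ of $N$. For a nonempty $T\subseteq N$ let $\overline{T}=T\cap S_k$, where $k=\min\{j: S_j\cap T\neq\emptyset\}$. For a welfare function $V$, the generalized weighted marginal contribution rule is $$f^{V}_{GWMC}[\omega](i,S)=\lambda_i\bigl(V(\overline{S}_k)-V(\overline{S}_k\setminus\{i\})\bigr),\qquad \overline{S}_k=S\setminus\bigcup_{\ell<k}S_\ell,\quad i\in S_k.$$ Every welfare function can be written uniquely as $V=\sum_{T\subseteq N}q^V_T\,W^T$, where $W^T(S)=1$ if $T\subseteq S$ and $W^T(S)=0$ otherwise. For $V$ with $V(\emptyset)=0$ (so that $q^V_\emptyset=0$), let $$h_\omega(V)=\sum_{\emptyset\ne T\subseteq N}\frac{q^V_T}{\sum_{j\in\overline{T}}\lambda_j}\,W^T .$$ **Theorem.** All games in $\mathcal{G}(N,f^{\mathbb{W}},\mathbb{W})$ possess a pure Nash equilibrium if and only if there exist a weight system $\omega$ and a mapping $g_{MC}$ from $\mathbb{W}$ to welfare functions such that, for every $W\in\mathbb{W}$, $f^W=f^{W''}_{GWMC}[\omega]$ with $W''=g_{MC}(W)=h_\omega(W')$,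 where $W'=g_{SV}(W)$ is the welfare actually distributed by $f^W$, namely $W'(S)=\sum_{i\in S}f^W(i,S)$ for all $S\subseteq N$. -/

import Mathlib

namespace WelfareSharing

/-- A (local) welfare function `W : 2^N → ℝ`. -/
abbrev WelfareFunction (N : Type*) := Finset N → ℝ

/-- A (local) distribution rule: `share i S` is the amount allocated to player `i` when the set of
players sharing is `S`; it is zero when `i` is not in `S`. -/
@[ext]
structure DistributionRule (N : Type*) where
  share : N → Finset N → ℝ
  share_eq_zero : ∀ (i : N) (S : Finset N), i ∉ S → share i S = 0

/-- The strategic data of a welfare sharing game with player set `N` and local welfare functions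
from `𝕎`: a finite set of at least two resources, the local welfare function at every resource, and
a nonempty set of actions (sets of resources) for every player. As a distribution rule is attached
to each member of `𝕎`, resources with the same welfare function have the same rule. -/
structure WelfareGame {N : Type*} (𝕎 : Set (WelfareFunction N)) where
  Resource : Type
  [fintypeResource : Fintype Resource]
  [decEqResource : DecidableEq Resource]
  one_lt_card : 1 < Fintype.card Resource
  welfare : Resource → 𝕎
  actions : N → Finset (Finset Resource)
  actions_nonempty : ∀ i, (actions i).Nonempty

attribute [instance] WelfareGame.fintypeResource WelfareGame.decEqResource

namespace WelfareGame

variable {N : Type*} [Fintype N] [DecidableEq N] {𝕎 : Set (WelfareFunction N)}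

/-- The set of players allocated to resource `r` in the allocation `a`. -/
def users (G : WelfareGame 𝕎) (a : N → Finset G.Resource) (r : G.Resource) : Finset N :=
  Finset.univ.filter fun i => r ∈ a i

/-- The utility of player `i` in the allocation `a`, when the welfare `W ∈ 𝕎` is distributed by the
rule `f W`. -/
def utility (G : WelfareGame 𝕎) (f : 𝕎 → DistributionRule N) (a : N → Finset G.Resource)
    (i : N) : ℝ :=
  ∑ r ∈ a i, (f (G.welfare r)).share i (G.users a r)

/-- `a` is a pure Nash equilibrium: it is feasible, and no player gains by changing its own action
to another one that is available to it. -/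
def IsPureNash (G : WelfareGame 𝕎) (f : 𝕎 → DistributionRule N)
    (a : N → Finset G.Resource) : Prop :=
  (∀ i, a i ∈ G.actions i) ∧
    ∀ i, ∀ b ∈ G.actions i, G.utility f (Function.update a i b) i ≤ G.utility f a i

end WelfareGame

/-- A weight system `(λ, Σ)`: strictly positive player weights, and an ordered partition
`Σ = (S_1, …, S_m)` of the players into nonempty classes, given by the map that sends a player to
the index of its class (a smaller index is a higher priority). -/
structure WeightSystem (N : Type*) where
  weight : N → ℝ
  weight_pos : ∀ i, 0 < weight i
  numClasses : ℕ
  cls : N → Fin numClasses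
  cls_surjective : Function.Surjective cls

namespace WeightSystem

variable {N : Type*} [Fintype N] [DecidableEq N]

/-- The `k`-th class of the ordered partition. -/
def part (ω : WeightSystem N) (k : Fin ω.numClasses) : Finset N :=
  Finset.univ.filter fun i => ω.cls i = k

/-- The highest-priority part of a coalition `T`: its members in the first class that meets `T`. -/
def top (ω : WeightSystem N) (T : Finset N) : Finset N :=
  T.filter fun i => ∀ j ∈ T, ω.cls i ≤ ω.cls j

/-- What remains of `S` once the classes that precede the `k`-th one are removed. -/
def remaining (ω : WeightSystem N) (S : Finset N) (k : Fin ω.numClasses) : Finset N :=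
  S \ (Finset.univ.filter fun l => l < k).biUnion ω.part

end WeightSystem

section

variable {N : Type*} [Fintype N] [DecidableEq N]

/-- The generalized weighted marginal contribution rule on the ground welfare function `W`. -/
def gwmc (ω : WeightSystem N) (W : WelfareFunction N) : DistributionRule N where
  share i S := ω.weight i *
    (W (ω.remaining S (ω.cls i)) - W ((ω.remaining S (ω.cls i)).erase i))
  share_eq_zero i S hi := by
    have h : i ∉ ω.remaining S (ω.cls i) := fun h => hi (Finset.mem_sdiff.1 h).1
    rw [Finset.erase_eq_of_notMem h, sub_self, mul_zero]

/-- The inclusion function (unanimity game) of the coalition `T`. -/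
def inclusion (T : Finset N) : WelfareFunction N := fun S => if T ⊆ S then 1 else 0

/-- The coefficient of `W` on the inclusion function of `T`, in the basis of the inclusion
functions. -/
def coeff (W : WelfareFunction N) (T : Finset N) : ℝ :=
  ∑ R ∈ T.powerset, (-1 : ℝ) ^ (T.card - R.card) * W R

/-- The welfare that is actually distributed by a rule. -/
def distributed (f : DistributionRule N) : WelfareFunction N := fun S => ∑ i ∈ S, f.share i S

/-- The map `h` on welfare functions that vanish at `∅`: the coefficient of `W` on each inclusion
function (which is zero for `T = ∅`) is divided by the total weight of the highest-priority part of
the coalition. -/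
noncomputable def rescale (ω : WeightSystem N) (W : WelfareFunction N) : WelfareFunction N :=
  ∑ T ∈ Finset.univ.filter fun T : Finset N => T.Nonempty,
    (coeff W T / ∑ j ∈ ω.top T, ω.weight j) • inclusion T

end

end WelfareSharing

/-! ### Equilibria under GWMC rules: a lexicographic potential -/

namespace WelfareSharing

variable {N : Type*} [Fintype N] {𝕎 : Set (WelfareFunction N)}

/-! For GWMC rules with a common weight system, a deviation by a player of class `k` leaves the
potentials of all later classes fixed and changes that of class `k` in proportion to the player's
gain. A lexicographic maximum of the potentials, last class first, is therefore an equilibrium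
(`WelfareGame.exists_isPureNash_gwmc`).

Conversely, a `Bond` records how two players affect each other's shares at a resource whose other
users are fixed. Doubling the resource turns this into a spin interaction with two possibly unequal
forces, and equilibrium existence yields a stable spin configuration for every choice of real
couplings (`exists_spinStable`). A frustrated cycle in which every player is governed by the
preceding bond has no stable configuration. Hence, around a closed walk, the absolute forces have
the same product on the sources as on the targets (`Walk.eq_of_closed`). This makes forces
proportional to weights within classes of mutually outranking players, while one-sided forces order
the classes (`exists_weightSystem`).

By Möbius inversion, the coefficients of the shares on a coalition `T` are combinations of forces.
They vanish off `ω.top T`, are proportional to the weights on it, and sum to the coefficient of the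
distributed welfare, which determines the rule (`eq_gwmc_of_bonds`). -/

theorem WelfareGame.utility_eq_sum_univ (G : WelfareGame 𝕎) (f : 𝕎 → DistributionRule N)
    (a : N → Finset G.Resource) (i : N) :
    G.utility f a i = ∑ r, (f (G.welfare r)).share i (G.users a r) := by
  unfold WelfareGame.utility
  refine Finset.sum_subset (Finset.subset_univ _) fun r _ hr => ?_
  exact (f (G.welfare r)).share_eq_zero i _ (by simpa [WelfareGame.users] using hr)

variable [DecidableEq N]

theorem WeightSystem.mem_remaining (ω : WeightSystem N) {S : Finset N} {k : Fin ω.numClasses}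
    {i : N} : i ∈ ω.remaining S k ↔ i ∈ S ∧ k ≤ ω.cls i := by
  simp [WeightSystem.remaining, WeightSystem.part]

/-- The potential of the `k`-th class of players: the total ground welfare that remains once the
classes of higher priority are removed. -/
def WelfareGame.classPotential (G : WelfareGame 𝕎) (ω : WeightSystem N)
    (V : 𝕎 → WelfareFunction N) (a : N → Finset G.Resource) (k : Fin ω.numClasses) : ℝ :=
  ∑ r, V (G.welfare r) (ω.remaining (G.users a r) k)

theorem WelfareGame.remaining_users_update (G : WelfareGame 𝕎) (ω : WeightSystem N)
    (a : N → Finset G.Resource) (i : N) (b : Finset G.Resource) (r : G.Resource)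
    {k : Fin ω.numClasses} (hk : ω.cls i < k) :
    ω.remaining (G.users (Function.update a i b) r) k = ω.remaining (G.users a r) k := by
  ext j
  simp only [WeightSystem.mem_remaining, WelfareGame.users, Finset.mem_filter, Finset.mem_univ,
    true_and]
  by_cases hj : j = i
  · subst hj
    simp [not_le.2 hk]
  · simp [Function.update_of_ne hj]

theorem WelfareGame.erase_remaining_users_update (G : WelfareGame 𝕎) (ω : WeightSystem N)
    (a : N → Finset G.Resource) (i : N) (b : Finset G.Resource) (r : G.Resource)
    (k : Fin ω.numClasses) :
    (ω.remaining (G.users (Function.update a i b) r) k).erase i =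
      (ω.remaining (G.users a r) k).erase i := by
  ext j
  simp only [WeightSystem.mem_remaining, WelfareGame.users, Finset.mem_filter, Finset.mem_univ,
    true_and, Finset.mem_erase]
  by_cases hj : j = i
  · simp [hj]
  · simp [Function.update_of_ne hj]

theorem WelfareGame.utility_gwmc_update_sub (G : WelfareGame 𝕎) (ω : WeightSystem N)
    (V : 𝕎 → WelfareFunction N) (a : N → Finset G.Resource) (i : N) (b : Finset G.Resource) :
    G.utility (fun W => gwmc ω (V W)) (Function.update a i b) i -
        G.utility (fun W => gwmc ω (V W)) a i =
      ω.weight i * (G.classPotential ω V (Function.update a i b) (ω.cls i) -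
        G.classPotential ω V a (ω.cls i)) := by
  simp only [WelfareGame.utility_eq_sum_univ, WelfareGame.classPotential, gwmc,
    ← Finset.sum_sub_distrib, Finset.mul_sum, WelfareGame.erase_remaining_users_update]
  exact Finset.sum_congr rfl fun r _ => by ring

theorem WelfareGame.exists_isPureNash_gwmc (G : WelfareGame 𝕎) (ω : WeightSystem N)
    (V : 𝕎 → WelfareFunction N) :
    ∃ a : N → Finset G.Resource, G.IsPureNash (fun W => gwmc ω (V W)) a := by
  -- The order dual makes the lexicographic comparison start from the class of lowest priority.
  let Φ : (N → Finset G.Resource) → Lex ((Fin ω.numClasses)ᵒᵈ → ℝ) :=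
    fun a => toLex fun k => G.classPotential ω V a (OrderDual.ofDual k)
  obtain ⟨a, ha, hmax⟩ := Finset.exists_max_image (Fintype.piFinset G.actions) Φ
    (Fintype.piFinset_nonempty.2 G.actions_nonempty)
  rw [Fintype.mem_piFinset] at ha
  refine ⟨a, ha, fun i b hb => ?_⟩
  rw [← sub_nonpos, G.utility_gwmc_update_sub]
  refine mul_nonpos_of_nonneg_of_nonpos (ω.weight_pos i).le ?_
  by_contra! hlt
  rw [sub_pos] at hlt
  refine (hmax (Function.update a i b) ?_).not_gt ?_
  · rw [Fintype.mem_piFinset]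
    intro j
    by_cases hj : j = i
    · subst hj
      simpa using hb
    · simpa [Function.update_of_ne hj] using ha j
  · refine ⟨OrderDual.toDual (ω.cls i), fun k hk => ?_, hlt⟩
    have hk' : ω.cls i < OrderDual.ofDual k := hk
    exact Finset.sum_congr rfl fun r _ => by rw [G.remaining_users_update ω a i b r hk']

end WelfareSharing

/-! ### Spin games: from equilibria to stable configurations -/

namespace WelfareSharing

open Filter Topology

/-- The spin `1` or `-1` that encodes a Boolean choice. -/
def spin (b : Bool) : ℝ := if b then 1 else -1

theorem spin_mul_self (b : Bool) : spin b * spin b = 1 := by cases b <;> simp [spin]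

/-- An interaction of two distinct players at a resource that is always used by the players in
`fixed`, to which neither of them belongs. -/
structure Bond {N : Type*} (𝕎 : Set (WelfareFunction N)) where
  fst : N
  snd : N
  ne : fst ≠ snd
  welfare : 𝕎
  fixed : Finset N
  fst_notMem : fst ∉ fixed
  snd_notMem : snd ∉ fixed

variable {N : Type*} [DecidableEq N] {𝕎 : Set (WelfareFunction N)}

namespace Bond

/-- The change in the share of the first player when the second one joins. -/
def left (f : 𝕎 → DistributionRule N) (B : Bond 𝕎) : ℝ :=
  (f B.welfare).share B.fst (insert B.fst (insert B.snd B.fixed)) -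
    (f B.welfare).share B.fst (insert B.fst B.fixed)

/-- The change in the share of the second player when the first one joins. -/
def right (f : 𝕎 → DistributionRule N) (B : Bond 𝕎) : ℝ :=
  (f B.welfare).share B.snd (insert B.fst (insert B.snd B.fixed)) -
    (f B.welfare).share B.snd (insert B.snd B.fixed)

/-- The change in the share of the player `p` caused by the interaction. -/
def force (f : 𝕎 → DistributionRule N) (B : Bond 𝕎) (p : N) : ℝ :=
  (if p = B.fst then B.left f else 0) + if p = B.snd then B.right f else 0

/-- The same interaction with the two players exchanged. -/
def swap (B : Bond 𝕎) : Bond 𝕎 where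
  fst := B.snd
  snd := B.fst
  ne := B.ne.symm
  welfare := B.welfare
  fixed := B.fixed
  fst_notMem := B.snd_notMem
  snd_notMem := B.fst_notMem

theorem left_swap (f : 𝕎 → DistributionRule N) (B : Bond 𝕎) : B.swap.left f = B.right f := by
  simp [left, right, swap, Finset.insert_comm]

theorem right_swap (f : 𝕎 → DistributionRule N) (B : Bond 𝕎) : B.swap.right f = B.left f := by
  simp [left, right, swap, Finset.insert_comm]

/-- The users of copy `c` of the resource of `B` when the players choose `t`: the first player uses
the copy that it chooses, and so does the second one, up to a flip by `φ`. -/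
def users (B : Bond 𝕎) (t : N → Bool) (φ c : Bool) : Finset N :=
  B.fixed ∪ (if t B.fst = c then {B.fst} else ∅) ∪ if (t B.snd ^^ φ) = c then {B.snd} else ∅

theorem sum_share_fst (f : 𝕎 → DistributionRule N) (B : Bond 𝕎) (t : N → Bool) (φ : Bool) :
    ∑ c, (f B.welfare).share B.fst (B.users t φ c) =
      (f B.welfare).share B.fst (insert B.fst B.fixed) +
        if t B.fst = (t B.snd ^^ φ) then B.left f else 0 := by
  have h0 : (f B.welfare).share B.fst B.fixed = 0 :=
    (f B.welfare).share_eq_zero _ _ B.fst_notMem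
  have h1 : (f B.welfare).share B.fst (insert B.snd B.fixed) = 0 :=
    (f B.welfare).share_eq_zero _ _ (by simp [B.ne, B.fst_notMem])
  rw [Fintype.sum_bool]
  unfold users left
  cases t B.fst <;> cases t B.snd <;> cases φ <;>
    simp [h0, h1, Finset.union_singleton, Finset.insert_comm B.snd B.fst]

theorem sum_share_snd (f : 𝕎 → DistributionRule N) (B : Bond 𝕎) (t : N → Bool) (φ : Bool) :
    ∑ c, (f B.welfare).share B.snd (B.users t φ c) =
      (f B.welfare).share B.snd (insert B.snd B.fixed) +
        if t B.fst = (t B.snd ^^ φ) then B.right f else 0 := by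
  have h0 : (f B.welfare).share B.snd B.fixed = 0 :=
    (f B.welfare).share_eq_zero _ _ B.snd_notMem
  have h1 : (f B.welfare).share B.snd (insert B.fst B.fixed) = 0 :=
    (f B.welfare).share_eq_zero _ _ (by simp [B.ne.symm, B.snd_notMem])
  rw [Fintype.sum_bool]
  unfold users right
  cases t B.fst <;> cases t B.snd <;> cases φ <;>
    simp [h0, h1, Finset.union_singleton, Finset.insert_comm B.snd B.fst]

/-- The two players meet on a copy exactly when `spin (!φ)` times their spins is `1`, and a flip by
either toggles this. A fixed player uses both copies whatever its spin, so it feels no force. -/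
theorem sum_share_sub_sum_share_update (f : 𝕎 → DistributionRule N) (B : Bond 𝕎) (t : N → Bool)
    (φ : Bool) (p : N) :
    ∑ c, (f B.welfare).share p (B.users t φ c) -
        ∑ c, (f B.welfare).share p (B.users (Function.update t p (!t p)) φ c) =
      spin (!φ) * (spin (t B.fst) * spin (t B.snd)) * B.force f p := by
  by_cases h1 : p = B.fst
  · subst h1
    rw [sum_share_fst, sum_share_fst, Function.update_self, Function.update_of_ne B.ne.symm]
    simp only [force, B.ne, if_true, if_false]
    cases t B.fst <;> cases t B.snd <;> cases φ <;> simp [spin]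
  by_cases h2 : p = B.snd
  · subst h2
    rw [sum_share_snd, sum_share_snd, Function.update_self, Function.update_of_ne B.ne]
    simp only [force, B.ne.symm, if_true, if_false]
    cases t B.fst <;> cases t B.snd <;> cases φ <;> simp [spin]
  · simp [force, h1, h2, users, Function.update_of_ne (Ne.symm h1),
      Function.update_of_ne (Ne.symm h2)]

end Bond

/-- The resources that a player with choice `b` uses, when every bond has two copies of its
resource. -/
def spinAction {E : Type} [Fintype E] [DecidableEq E] (B : E → Bond 𝕎) (φ : E → Bool) (p : N)
    (b : Bool) : Finset (E × Bool) :=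
  Finset.univ.filter fun r => p ∈ (B r.1).fixed ∨ (p = (B r.1).fst ∧ b = r.2) ∨
    (p = (B r.1).snd ∧ (b ^^ φ r.1) = r.2)

/-- The game in which every player chooses a spin, and in which the bonds are the interactions. -/
abbrev spinGame {E : Type} [Fintype E] [DecidableEq E] [Nonempty E] (B : E → Bond 𝕎) (φ : E → Bool) :
    WelfareGame 𝕎 where
  Resource := E × Bool
  one_lt_card := by
    have := Fintype.card_pos (α := E)
    rw [Fintype.card_prod, Fintype.card_bool]
    omega
  welfare r := (B r.1).welfare
  actions p := Finset.univ.image (spinAction B φ p)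
  actions_nonempty p := Finset.univ_nonempty.image _

/-- The allocation of the spin game in which the players choose `t`. -/
def spinProfile {E : Type} [Fintype E] [DecidableEq E] [Nonempty E] (B : E → Bond 𝕎)
    (φ : E → Bool) (t : N → Bool) : N → Finset (spinGame B φ).Resource :=
  fun p => spinAction B φ p (t p)

theorem mem_actions_spinGame {E : Type} [Fintype E] [DecidableEq E] [Nonempty E] (B : E → Bond 𝕎)
    (φ : E → Bool) (p : N) (b : Finset (E × Bool)) :
    b ∈ (spinGame B φ).actions p ↔ ∃ c, spinAction B φ p c = b := by
  simp only [spinGame, Finset.mem_image, Finset.mem_univ, true_and]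

variable [Fintype N]

theorem users_spinProfile {E : Type} [Fintype E] [DecidableEq E] [Nonempty E] (B : E → Bond 𝕎)
    (φ : E → Bool) (t : N → Bool) (r : E × Bool) :
    (spinGame B φ).users (spinProfile B φ t) r = (B r.1).users t (φ r.1) r.2 := by
  ext p
  have hmem : p ∈ (spinGame B φ).users (spinProfile B φ t) r ↔ p ∈ (B r.1).fixed ∨
      (p = (B r.1).fst ∧ t p = r.2) ∨ (p = (B r.1).snd ∧ (t p ^^ φ r.1) = r.2) := by
    rw [WelfareGame.users, Finset.mem_filter, and_iff_right (Finset.mem_univ _), spinProfile,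
      spinAction, Finset.mem_filter, and_iff_right (Finset.mem_univ _)]
  rw [hmem, Bond.users, Finset.mem_union, Finset.mem_union, or_assoc]
  refine or_congr Iff.rfl (or_congr ?_ ?_)
  · split_ifs with h
    · simp only [Finset.mem_singleton, and_iff_left_iff_imp]
      rintro rfl
      exact h
    · simp only [Finset.notMem_empty, iff_false, not_and]
      rintro rfl
      exact h
  · split_ifs with h
    · simp only [Finset.mem_singleton, and_iff_left_iff_imp]
      rintro rfl
      exact h
    · simp only [Finset.notMem_empty, iff_false, not_and]
      rintro rfl
      exact h

theorem utility_spinProfile {E : Type} [Fintype E] [DecidableEq E] [Nonempty E] (B : E → Bond 𝕎)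
    (φ : E → Bool) (f : 𝕎 → DistributionRule N) (t : N → Bool) (p : N) :
    (spinGame B φ).utility f (spinProfile B φ t) p =
      ∑ e, ∑ c, (f (B e).welfare).share p ((B e).users t (φ e) c) := by
  rw [WelfareGame.utility_eq_sum_univ]
  simp only [users_spinProfile]
  exact Fintype.sum_prod_type _

/-- A choice of spins in which no player gains by flipping its own. -/
def SpinStable {E : Type} [Fintype E] (B : E → Bond 𝕎) (w : E → ℝ) (f : 𝕎 → DistributionRule N)
    (t : N → Bool) : Prop :=
  ∀ p, 0 ≤ ∑ e, w e * (spin (t (B e).fst) * spin (t (B e).snd)) * (B e).force f p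

theorem exists_spinStable_of_sign {f : 𝕎 → DistributionRule N}
    (h : ∀ G : WelfareGame 𝕎, ∃ a : N → Finset G.Resource, G.IsPureNash f a)
    {E : Type} [Fintype E] (B : E → Bond 𝕎) (φ : E → Bool) :
    ∃ t, SpinStable B (fun e => spin (!φ e)) f t := by
  classical
  rcases isEmpty_or_nonempty E with hE | hE
  · exact ⟨fun _ => true, fun p => by simp⟩
  obtain ⟨a, ha, hopt⟩ := h (spinGame B φ)
  have ha' : ∀ p, ∃ b, spinAction B φ p b = a p := fun p =>
    (mem_actions_spinGame B φ p _).1 (ha p)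
  choose t ht using ha'
  obtain rfl : spinProfile B φ t = a := funext ht
  refine ⟨t, fun p => ?_⟩
  have hp := hopt p (spinAction B φ p (!t p)) ((mem_actions_spinGame B φ p _).2 ⟨_, rfl⟩)
  have hup : Function.update (spinProfile B φ t) p (spinAction B φ p (!t p)) =
      spinProfile B φ (Function.update t p (!t p)) := by
    ext1 q
    by_cases hq : q = p
    · subst hq; simp [spinProfile]
    · simp [spinProfile, Function.update_of_ne hq]
  rw [hup, utility_spinProfile, utility_spinProfile, ← sub_nonneg,
    ← Finset.sum_sub_distrib] at hp
  simpa only [Bond.sum_share_sub_sum_share_update] using hp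

theorem exists_spinStable_of_nat {f : 𝕎 → DistributionRule N}
    (h : ∀ G : WelfareGame 𝕎, ∃ a : N → Finset G.Resource, G.IsPureNash f a)
    {E : Type} [Fintype E] (B : E → Bond 𝕎) (φ : E → Bool) (n : E → ℕ) :
    ∃ t, SpinStable B (fun e => n e * spin (!φ e)) f t := by
  -- An integer coupling is realised by repeating the bond.
  obtain ⟨t, ht⟩ := exists_spinStable_of_sign h (E := Σ e, Fin (n e)) (fun x => B x.1)
    (fun x => φ x.1)
  refine ⟨t, fun p => (ht p).trans_eq ?_⟩
  rw [Fintype.sum_sigma]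
  exact Finset.sum_congr rfl fun e _ => by simp [mul_assoc]

/-- Instability is a strict inequality, hence open in the couplings. There are finitely many
configurations, so if all were unstable for `w`, all would be unstable for some rational couplings
near `w`. Clearing denominators contradicts the integer case. -/
theorem exists_spinStable {f : 𝕎 → DistributionRule N}
    (h : ∀ G : WelfareGame 𝕎, ∃ a : N → Finset G.Resource, G.IsPureNash f a)
    {E : Type} [Fintype E] (B : E → Bond 𝕎) (w : E → ℝ) :
    ∃ t, SpinStable B w f t := by
  by_contra! hcon
  have hlim : ∀ e, Tendsto (fun K : ℝ => (⌊|w e| * K⌋₊ : ℝ) / K * spin (!decide (w e < 0))) atTop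
      (𝓝 (w e)) := fun e => by
    have hw : |w e| * spin (!decide (w e < 0)) = w e := by
      rcases lt_or_ge (w e) 0 with hw | hw
      · simp [spin, hw, abs_of_neg hw]
      · simp [spin, hw.not_gt, abs_of_nonneg hw]
    have := (tendsto_nat_floor_mul_div_atTop (R := ℝ) (abs_nonneg (w e))).mul_const
      (spin (!decide (w e < 0)))
    rwa [hw] at this
  have hev : ∀ t : N → Bool, ∀ᶠ K : ℝ in atTop, ¬ SpinStable B
      (fun e => (⌊|w e| * K⌋₊ : ℝ) / K * spin (!decide (w e < 0))) f t := fun t => by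
    have := hcon t
    unfold SpinStable at this
    push Not at this
    obtain ⟨p, hp⟩ := this
    have hl : Tendsto (fun K : ℝ => ∑ e, (⌊|w e| * K⌋₊ : ℝ) / K * spin (!decide (w e < 0)) *
        (spin (t (B e).fst) * spin (t (B e).snd)) * (B e).force f p) atTop
        (𝓝 (∑ e, w e * (spin (t (B e).fst) * spin (t (B e).snd)) * (B e).force f p)) :=
      tendsto_finsetSum _ fun e _ => ((hlim e).mul_const _).mul_const _
    filter_upwards [hl.eventually_lt_const hp] with K hK hst
    exact (hst p).not_gt hK
  obtain ⟨K, hK, hK0⟩ := ((eventually_all.2 hev).and (eventually_gt_atTop (0 : ℝ))).exists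
  obtain ⟨t, ht⟩ := exists_spinStable_of_nat h B (fun e => decide (w e < 0))
    (fun e => ⌊|w e| * K⌋₊)
  refine hK t fun p => ?_
  have := div_nonneg (ht p) hK0.le
  rw [Finset.sum_div] at this
  refine this.trans_eq (Finset.sum_congr rfl fun e _ => ?_)
  ring

end WelfareSharing

/-! ### Closed walks of forces, and the weight system -/

namespace WelfareSharing

open Filter Topology

theorem exists_scaling_of_prod_lt_prod {k : ℕ} {a b : ℕ → ℝ} (ha : ∀ i < k, 0 ≤ a i)
    (hb : ∀ i < k, 0 ≤ b i) (hlt : ∏ i ∈ Finset.range k, a i < ∏ i ∈ Finset.range k, b i) :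
    ∃ c : ℕ → ℝ, (∀ i < k, 0 < c i) ∧ (∀ i, i + 1 < k → c (i + 1) * a (i + 1) < c i * b i) ∧
      c 0 * a 0 < c (k - 1) * b (k - 1) := by
  obtain _ | m := k
  · simp at hlt
  have hb' : ∀ i < m + 1, 0 < b i := fun i hi => (hb i hi).lt_of_ne' fun h0 => by
    rw [Finset.prod_eq_zero (Finset.mem_range.2 hi) h0] at hlt
    exact hlt.not_ge (Finset.prod_nonneg fun j hj => ha j (Finset.mem_range.1 hj))
  have hcont : Tendsto (fun ε : ℝ => ∏ i ∈ Finset.range (m + 1), (a i + ε)) (𝓝[>] 0)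
      (𝓝 (∏ i ∈ Finset.range (m + 1), a i)) := by
    have : Continuous fun ε : ℝ => ∏ i ∈ Finset.range (m + 1), (a i + ε) := by fun_prop
    simpa using (this.tendsto 0).mono_left nhdsWithin_le_nhds
  -- Adding `ε` keeps the denominators positive where `a` vanishes and makes the inequalities
  -- strict. The factors `c` are chosen so that `c (i + 1) * (a (i + 1) + ε) = c i * b i`.
  obtain ⟨ε, hε, hε0⟩ := ((hcont.eventually_lt_const hlt).and self_mem_nhdsWithin).exists
  replace hε0 : 0 < ε := hε0
  have hP : ∀ i < m + 1, 0 < ∏ t ∈ Finset.range i, (a (t + 1) + ε) := fun i hi =>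
    Finset.prod_pos fun t ht => by
      have := ha (t + 1) (by have := Finset.mem_range.1 ht; omega)
      positivity
  have hQ : ∀ i < m + 1, 0 < ∏ t ∈ Finset.range i, b t := fun i hi =>
    Finset.prod_pos fun t ht => hb' t ((Finset.mem_range.1 ht).trans hi)
  have hc : ∀ i < m + 1,
      0 < (∏ t ∈ Finset.range i, b t) / ∏ t ∈ Finset.range i, (a (t + 1) + ε) :=
    fun i hi => div_pos (hQ i hi) (hP i hi)
  refine ⟨fun i => (∏ t ∈ Finset.range i, b t) / ∏ t ∈ Finset.range i, (a (t + 1) + ε), hc,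
    fun i hi => ?_, ?_⟩
  · refine (mul_lt_mul_of_pos_left (lt_add_of_pos_right _ hε0) (hc _ hi)).trans_eq ?_
    have h1 : a (i + 1) + ε ≠ 0 := by have := ha _ hi; positivity
    have h2 := (hP i (by omega)).ne'
    simp only [Finset.prod_range_succ]
    field_simp
  · have hm := hP m (by omega)
    simp only [Finset.range_zero, Finset.prod_empty, div_one, one_mul, Nat.add_sub_cancel]
    rw [div_mul_eq_mul_div, lt_div_iff₀ hm, ← Finset.prod_range_succ]
    refine lt_trans ?_ hε
    rw [Finset.prod_range_succ', mul_comm]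
    exact mul_lt_mul_of_pos_left (lt_add_of_pos_right _ hε0) hm

variable {N : Type*} [DecidableEq N] {𝕎 : Set (WelfareFunction N)}

/-- The players `p` and `q` interact with forces of absolute values `x` and `y`. -/
def Interacts (f : 𝕎 → DistributionRule N) (p q : N) (x y : ℝ) : Prop :=
  ∃ B : Bond 𝕎, B.fst = p ∧ B.snd = q ∧ |B.left f| = x ∧ |B.right f| = y

theorem Interacts.symm {f : 𝕎 → DistributionRule N} {p q : N} {x y : ℝ}
    (h : Interacts f p q x y) : Interacts f q p y x := by
  obtain ⟨B, rfl, rfl, rfl, rfl⟩ := h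
  exact ⟨B.swap, rfl, rfl, by rw [B.left_swap], by rw [B.right_swap]⟩

theorem Interacts.nonneg {f : 𝕎 → DistributionRule N} {p q : N} {x y : ℝ}
    (h : Interacts f p q x y) : 0 ≤ x := by
  obtain ⟨B, rfl, rfl, rfl, rfl⟩ := h
  exact abs_nonneg _

/-- There is a walk from `p` to `q` along which the forces multiply to `x` on the sources and to `y`
on the targets. -/
def Walk (f : 𝕎 → DistributionRule N) (p q : N) (x y : ℝ) : Prop :=
  ∃ (k : ℕ) (v : ℕ → N) (a b : ℕ → ℝ), (∀ i < k, Interacts f (v i) (v (i + 1)) (a i) (b i)) ∧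
    v 0 = p ∧ v k = q ∧ ∏ i ∈ Finset.range k, a i = x ∧ ∏ i ∈ Finset.range k, b i = y

namespace Walk

variable {f : 𝕎 → DistributionRule N} {p q r : N} {x y x' y' : ℝ}

theorem refl (f : 𝕎 → DistributionRule N) (p : N) : Walk f p p 1 1 :=
  ⟨0, fun _ => p, fun _ => 0, fun _ => 0, by simp, rfl, rfl, by simp, by simp⟩

theorem of_interacts (h : Interacts f p q x y) : Walk f p q x y := by
  refine ⟨1, fun i => if i = 0 then p else q, fun _ => x, fun _ => y, fun i hi => ?_, ?_⟩
  · obtain rfl : i = 0 := by omega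
    simpa using h
  · simp

theorem trans (h : Walk f p q x y) (h' : Walk f q r x' y') : Walk f p r (x * x') (y * y') := by
  obtain ⟨k, v, a, b, hk, rfl, hv, rfl, rfl⟩ := h
  obtain ⟨l, u, a', b', hl, hu, rfl, rfl, rfl⟩ := h'
  refine ⟨k + l, fun i => if i < k then v i else u (i - k),
    fun i => if i < k then a i else a' (i - k), fun i => if i < k then b i else b' (i - k),
    fun i hi => ?_, ?_, by simp, ?_, ?_⟩
  · rcases lt_trichotomy (i + 1) k with h1 | h1 | h1
    · simpa [h1, (Nat.lt_succ_self i).trans h1] using hk i (by omega)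
    · have h2 : i < k := by omega
      simpa [h2, h1, hu, ← hv] using hk i h2
    · have h2 : ¬ i < k := by omega
      have h3 : ¬ i + 1 < k := by omega
      have h4 : i + 1 - k = i - k + 1 := by omega
      simpa only [h2, h3, h4, if_false] using hl (i - k) (by omega)
  · rcases Nat.eq_zero_or_pos k with rfl | h0
    · simp [hu, hv]
    · simp [h0]
  all_goals
    rw [Finset.prod_range_add]
    refine congrArg₂ _ (Finset.prod_congr rfl fun i hi => ?_) (by simp)
    rw [if_pos (Finset.mem_range.1 hi)]

theorem symm (h : Walk f p q x y) : Walk f q p y x := by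
  obtain ⟨k, v, a, b, hk, rfl, rfl, rfl, rfl⟩ := h
  refine ⟨k, fun i => v (k - i), fun i => b (k - 1 - i), fun i => a (k - 1 - i), fun i hi => ?_,
    by simp, by simp, Finset.prod_range_reflect b k, Finset.prod_range_reflect a k⟩
  have h1 := (hk (k - 1 - i) (by omega)).symm
  have h2 : k - (i + 1) = k - 1 - i := by omega
  rw [show k - 1 - i + 1 = k - i by omega] at h1
  simpa only [h2] using h1

theorem nonneg (h : Walk f p q x y) : 0 ≤ x := by
  obtain ⟨k, v, a, b, hk, rfl, rfl, rfl, rfl⟩ := h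
  exact Finset.prod_nonneg fun i hi => (hk i (Finset.mem_range.1 hi)).nonneg

end Walk

/-- `p` has at least the priority of `q`. -/
def Outranks (f : 𝕎 → DistributionRule N) (p q : N) : Prop :=
  ∃ x y, 0 < x ∧ Walk f p q x y

theorem Outranks.refl (f : 𝕎 → DistributionRule N) (p : N) : Outranks f p p :=
  ⟨1, 1, one_pos, Walk.refl f p⟩

theorem Outranks.trans {f : 𝕎 → DistributionRule N} {p q r : N} (h : Outranks f p q)
    (h' : Outranks f q r) : Outranks f p r := by
  obtain ⟨x, y, hx, hw⟩ := h
  obtain ⟨x', y', hx', hw'⟩ := h'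
  exact ⟨_, _, mul_pos hx hx', hw.trans hw'⟩

variable [Fintype N]

/-- Forces of opposite signs would make a single bond a game of matching pennies. -/
theorem left_mul_right_nonneg {f : 𝕎 → DistributionRule N}
    (h : ∀ G : WelfareGame 𝕎, ∃ a : N → Finset G.Resource, G.IsPureNash f a) (B : Bond 𝕎) :
    0 ≤ B.left f * B.right f := by
  obtain ⟨t, ht⟩ := exists_spinStable h (fun _ : Unit => B) (fun _ => 1)
  have h1 := ht B.fst
  have h2 := ht B.snd
  simp only [Finset.univ_unique, Finset.sum_singleton, one_mul, Bond.force, if_true, B.ne,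
    B.ne.symm, if_false, add_zero, zero_add] at h1 h2
  cases h3 : t B.fst <;> cases h4 : t B.snd <;> simp [h3, h4, spin] at h1 h2 <;> nlinarith

/-- Otherwise the bonds can be rescaled so that each player's incoming force exceeds its outgoing
one. Stability then makes every incoming bond satisfied, which is impossible if exactly one coupling
on the cycle is reversed. -/
theorem prod_le_prod_of_cycle {f : 𝕎 → DistributionRule N}
    (h : ∀ G : WelfareGame 𝕎, ∃ a : N → Finset G.Resource, G.IsPureNash f a)
    {k : ℕ} {v : ℕ → N} {a b : ℕ → ℝ}
    (hab : ∀ i < k, Interacts f (v i) (v (i + 1)) (a i) (b i)) (hv : v k = v 0)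
    (hinj : ∀ i < k, ∀ j < k, v i = v j → i = j) :
    ∏ i ∈ Finset.range k, b i ≤ ∏ i ∈ Finset.range k, a i := by
  by_contra! hlt
  have hk : 0 < k := Nat.pos_of_ne_zero fun h0 => by simp [h0] at hlt
  obtain ⟨c, hc0, hc1, hc2⟩ := exists_scaling_of_prod_lt_prod (fun i hi => (hab i hi).nonneg)
    (fun i hi => (hab i hi).symm.nonneg) hlt
  choose! B hB1 hB2 hBa hBb using fun i : Fin k => hab i i.2
  -- `δ` makes the force on the target of each bond nonnegative; `η` below reverses the closing
  -- bond, so that the cycle is frustrated.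
  let δ : Fin k → ℝ := fun e => if 0 ≤ (B e).right f then 1 else -1
  have hδ : ∀ e, δ e * (B e).right f = b e := fun e => by
    rw [← hBb]
    by_cases h0 : 0 ≤ (B e).right f
    · simp [δ, h0, abs_of_nonneg h0]
    · simp [δ, h0, abs_of_neg (not_le.1 h0)]
  have hδ' : ∀ e, |δ e| = 1 := fun e => by
    simp only [δ]
    split_ifs <;> simp
  let η : ℕ → ℝ := fun i => if i + 1 = k then -1 else 1
  have hη : ∀ i, |η i| = 1 := fun i => by
    simp only [η]
    split_ifs <;> simp
  have hspin : ∀ z, |spin z| = 1 := fun z => by cases z <;> simp [spin]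
  obtain ⟨t, ht⟩ := exists_spinStable h B (fun e => η e * c e * δ e)
  have hnext : ∀ j < k, ∃ j' < k, v j' = v (j + 1) ∧ c j' * a j' < c j * b j := by
    intro j hj
    rcases Nat.lt_or_ge (j + 1) k with h1 | h1
    · exact ⟨j + 1, h1, rfl, hc1 j h1⟩
    · obtain rfl : k = j + 1 := by omega
      exact ⟨0, hk, hv.symm, hc2⟩
  have hinj' : ∀ i < k, ∀ j < k, v (i + 1) = v (j + 1) → i = j := by
    intro i hi j hj hij
    rcases Nat.lt_or_ge (i + 1) k with h1 | h1 <;> rcases Nat.lt_or_ge (j + 1) k with h2 | h2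
    · have := hinj _ h1 _ h2 hij
      omega
    · rw [show j + 1 = k by omega, hv] at hij
      have := hinj _ h1 _ hk hij
      omega
    · rw [show i + 1 = k by omega, hv] at hij
      have := hinj _ hk _ h2 hij
      omega
    · omega
  have hpos : ∀ j < k, 0 < η j * (spin (t (v j)) * spin (t (v (j + 1)))) := by
    intro j hj
    obtain ⟨j', hj', hvj, hlt⟩ := hnext j hj
    have hX := ht (v (j + 1))
    simp only [Bond.force, mul_add, Finset.sum_add_distrib, hB1, hB2] at hX
    rw [Finset.sum_eq_single ⟨j', hj'⟩, Finset.sum_eq_single ⟨j, hj⟩] at hX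
    · simp only [← hvj, if_true] at hX
      have e1 : |η j' * c j' * δ ⟨j', hj'⟩ * (spin (t (v j')) * spin (t (v (j' + 1)))) *
          (B ⟨j', hj'⟩).left f| = c j' * a j' := by
        simp only [abs_mul, hη, hδ', hspin, hBa, abs_of_pos (hc0 j' hj'), one_mul, mul_one]
      have e2 : η j * c j * δ ⟨j, hj⟩ * (spin (t (v j)) * spin (t (v j'))) *
          (B ⟨j, hj⟩).right f = η j * (spin (t (v j)) * spin (t (v j'))) * (c j * b j) := by
        rw [← hδ ⟨j, hj⟩]
        ring
      rw [e2] at hX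
      have e3 := (le_abs_self _).trans_eq e1
      rw [hvj] at hX e3
      have e4 : |η j * (spin (t (v j)) * spin (t (v (j + 1))))| = 1 := by
        simp only [abs_mul, hη, hspin, mul_one]
      rcases eq_or_eq_neg_of_abs_eq e4 with e5 | e5
      · rw [e5]
        exact one_pos
      · rw [e5] at hX
        linarith
    · intro e _ he
      rw [if_neg, mul_zero]
      intro h0
      exact he (Fin.ext (hinj' _ e.2 _ hj h0.symm))
    · simp
    · intro e _ he
      rw [if_neg, mul_zero]
      intro h0
      exact he (Fin.ext (hinj _ e.2 _ hj' (h0.symm.trans hvj.symm)))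
    · simp
  have hconst : ∀ i < k, t (v i) = t (v 0) := by
    intro i
    induction i with
    | zero => simp
    | succ i ih =>
      intro hi
      have h1 := hpos i (by omega)
      rw [← ih (by omega)]
      simp only [η, if_neg hi.ne, one_mul] at h1
      cases h2 : t (v i) <;> cases h3 : t (v (i + 1)) <;> simp [h2, h3, spin] at h1 ⊢ <;> linarith
  have h1 := hpos (k - 1) (by omega)
  rw [hconst _ (by omega), show k - 1 + 1 = k by omega, hv, spin_mul_self] at h1
  simp only [η, show k - 1 + 1 = k by omega, if_true] at h1
  linarith

theorem prod_le_prod_of_closed {f : 𝕎 → DistributionRule N}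
    (h : ∀ G : WelfareGame 𝕎, ∃ a : N → Finset G.Resource, G.IsPureNash f a)
    (k : ℕ) (v : ℕ → N) (a b : ℕ → ℝ)
    (hab : ∀ i < k, Interacts f (v i) (v (i + 1)) (a i) (b i)) (hv : v k = v 0) :
    ∏ i ∈ Finset.range k, b i ≤ ∏ i ∈ Finset.range k, a i := by
  induction k using Nat.strong_induction_on generalizing v a b with
  | _ k ih =>
  by_cases hinj : ∀ i < k, ∀ j < k, v i = v j → i = j
  · exact prod_le_prod_of_cycle h hab hv hinj
  obtain ⟨i, j, hij, hjk, hvij⟩ : ∃ i j, i < j ∧ j < k ∧ v i = v j := by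
    push Not at hinj
    obtain ⟨i, hi, j, hj, hvij, hne⟩ := hinj
    rcases lt_or_gt_of_ne hne with h1 | h1
    · exact ⟨i, j, h1, hj, hvij⟩
    · exact ⟨j, i, h1, hi, hvij.symm⟩
  obtain ⟨d, rfl⟩ := Nat.exists_eq_add_of_le hij.le
  obtain ⟨m, rfl⟩ := Nat.exists_eq_add_of_le hjk.le
  -- Excising the closed stretch from `i` to `i + d` leaves a shorter closed walk, and the products
  -- factor accordingly.
  let skip : ℕ → ℕ := fun n => if n < i then n else n + d
  have hskip : ∀ n < i, skip n = n := fun n hn => if_pos hn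
  have hskip' : ∀ n, skip (i + n) = i + d + n := fun n => by
    simp only [skip, if_neg (show ¬ i + n < i by omega)]
    omega
  have hskip1 : ∀ n, v (skip (n + 1)) = v (skip n + 1) := fun n => by
    rcases Nat.lt_trichotomy (n + 1) i with h1 | h1 | h1
    · rw [hskip _ h1, hskip n (by omega)]
    · rw [hskip n (by omega), h1]
      have := hskip' 0
      rw [Nat.add_zero, Nat.add_zero] at this
      rw [this, hvij]
    · obtain ⟨l, rfl⟩ := Nat.exists_eq_add_of_le (show i ≤ n by omega)
      rw [add_assoc, hskip', hskip']
      rfl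
  have hsk0 : v (skip 0) = v 0 := by
    rcases Nat.eq_zero_or_pos i with h1 | h1
    · have := hskip' 0
      simp only [h1, Nat.add_zero, Nat.zero_add] at this
      rw [this]
      simpa [h1] using hvij.symm
    · rw [hskip 0 h1]
  have hinner := ih d (by omega) (fun n => v (i + n)) (fun n => a (i + n)) (fun n => b (i + n))
    (fun n hn => hab (i + n) (by omega)) hvij.symm
  have houter := ih (i + m) (by omega) (fun n => v (skip n)) (fun n => a (skip n))
    (fun n => b (skip n)) (fun n hn => by
      simp only [hskip1]
      refine hab (skip n) ?_
      simp only [skip]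
      split_ifs <;> omega) (by
      simp only [hskip', hsk0, hv])
  have hsplit : ∀ g : ℕ → ℝ, ∏ n ∈ Finset.range (i + d + m), g n =
      (∏ n ∈ Finset.range (i + m), g (skip n)) * ∏ n ∈ Finset.range d, g (i + n) := fun g => by
    rw [Finset.prod_range_add, Finset.prod_range_add, Finset.prod_range_add]
    simp only [hskip']
    rw [Finset.prod_congr rfl fun n hn => congrArg g (hskip n (Finset.mem_range.1 hn))]
    ring
  rw [hsplit, hsplit]
  refine mul_le_mul houter hinner (Finset.prod_nonneg fun n hn => ?_)
    (Finset.prod_nonneg fun n hn => ?_)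
  · exact (hab _ (by have := Finset.mem_range.1 hn; omega)).symm.nonneg
  · refine (hab (skip n) ?_).nonneg
    have := Finset.mem_range.1 hn
    simp only [skip]
    split_ifs <;> omega

/-- Reversing a walk exchanges the two products, so the inequality for closed walks holds both ways.
-/
theorem Walk.eq_of_closed {f : 𝕎 → DistributionRule N}
    (h : ∀ G : WelfareGame 𝕎, ∃ a : N → Finset G.Resource, G.IsPureNash f a) {p : N} {x y : ℝ}
    (hw : Walk f p p x y) : x = y := by
  have key : ∀ {x y : ℝ}, Walk f p p x y → y ≤ x := by
    rintro x y ⟨k, v, a, b, hk, h0, h1, rfl, rfl⟩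
    exact prod_le_prod_of_closed h k v a b hk (h1.trans h0.symm)
  exact le_antisymm (key hw.symm) (key hw)

/-- The weight of `p` is the ratio of target to source products along a walk to `p` from a
representative of its class. Comparing two such walks closed up by an interaction gives the
proportionality. -/
theorem exists_weight {f : 𝕎 → DistributionRule N}
    (h : ∀ G : WelfareGame 𝕎, ∃ a : N → Finset G.Resource, G.IsPureNash f a) :
    ∃ l : N → ℝ, (∀ p, 0 < l p) ∧ ∀ p q x y, Outranks f p q → Outranks f q p →
      Interacts f p q x y → x * l q = y * l p := by
  let s : Setoid N :=
    { r := fun p q => Outranks f p q ∧ Outranks f q p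
      iseqv :=
        { refl := fun p => ⟨.refl f p, .refl f p⟩
          symm := fun h => ⟨h.2, h.1⟩
          trans := fun h h' => ⟨h.1.trans h'.1, h'.2.trans h.2⟩ } }
  let base : N → N := fun p => (Quotient.mk s p).out
  have hbase : ∀ p, Outranks f (base p) p ∧ Outranks f p (base p) := fun p =>
    Quotient.mk_out (s := s) p
  have hwalk : ∀ p, ∃ x y, 0 < x ∧ 0 < y ∧ Walk f (base p) p x y := fun p => by
    obtain ⟨⟨x, y, hx, hw⟩, ⟨x', y', hx', hw'⟩⟩ := hbase p
    -- The round trip has positive source product, hence positive target product, so the outward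
    -- target product is nonzero.
    have heq := (hw.trans hw').eq_of_closed h
    exact ⟨x, y, hx, pos_of_mul_pos_left (heq ▸ mul_pos hx hx') hw'.symm.nonneg, hw⟩
  choose X Y hX hY hXY using hwalk
  refine ⟨fun p => Y p / X p, fun p => div_pos (hY p) (hX p), fun p q x y hpq hqp hint => ?_⟩
  have hb : base p = base q := congrArg Quotient.out (Quotient.sound (s := s) ⟨hpq, hqp⟩)
  have hq := hXY q
  rw [← hb] at hq
  have := (((hXY p).trans (.of_interacts hint)).trans hq.symm).eq_of_closed h
  have h1 := (hX p).ne'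
  have h2 := (hX q).ne'
  field_simp
  linarith

theorem exists_rank (f : 𝕎 → DistributionRule N) :
    ∃ (m : ℕ) (cls : N → Fin m), Function.Surjective cls ∧
      ∀ p q, Outranks f p q → cls p ≤ cls q ∧ (cls p = cls q → Outranks f q p) := by
  classical
  -- The rank is the number of players that outrank `p`, with the attained values renumbered
  -- consecutively so that no class is empty.
  let up : N → Finset N := fun p => Finset.univ.filter fun q => Outranks f q p
  let ranks : Finset ℕ := Finset.univ.image fun p => (up p).card
  let e := ranks.orderIsoOfFin rfl
  have hmem : ∀ p, (up p).card ∈ ranks := fun p => Finset.mem_image_of_mem _ (Finset.mem_univ p)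
  refine ⟨ranks.card, fun p => e.symm ⟨_, hmem p⟩, fun k => ?_, fun p q hpq => ?_⟩
  · obtain ⟨p, -, hp⟩ := Finset.mem_image.1 (e k).2
    exact ⟨p, by rw [OrderIso.symm_apply_eq]; exact Subtype.ext hp⟩
  · have hsub : up p ⊆ up q := fun r hr => by
      simp only [up, Finset.mem_filter, Finset.mem_univ, true_and] at hr ⊢
      exact hr.trans hpq
    refine ⟨e.symm.le_iff_le.2 (Finset.card_le_card hsub), fun heq => ?_⟩
    have hcard : (up p).card = (up q).card := congrArg Subtype.val (e.symm.injective heq)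
    have hq : q ∈ up q := by simp [up, Outranks.refl]
    rw [← Finset.eq_of_subset_of_card_le hsub hcard.ge] at hq
    simpa [up] using hq

theorem exists_weightSystem {f : 𝕎 → DistributionRule N}
    (h : ∀ G : WelfareGame 𝕎, ∃ a : N → Finset G.Resource, G.IsPureNash f a) :
    ∃ ω : WeightSystem N, ∀ B : Bond 𝕎,
      (ω.cls B.fst < ω.cls B.snd → B.right f = 0) ∧
      (ω.cls B.fst = ω.cls B.snd →
        B.left f * ω.weight B.snd = B.right f * ω.weight B.fst) := by
  obtain ⟨l, hl, hint⟩ := exists_weight h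
  obtain ⟨m, cls, hsurj, hcls⟩ := exists_rank f
  have hfst : ∀ B : Bond 𝕎, B.left f ≠ 0 → Outranks f B.fst B.snd := fun B hB =>
    ⟨_, _, abs_pos.2 hB, .of_interacts ⟨B, rfl, rfl, rfl, rfl⟩⟩
  have hsnd : ∀ B : Bond 𝕎, B.right f ≠ 0 → Outranks f B.snd B.fst := fun B hB =>
    hfst B.swap (by rwa [B.left_swap])
  refine ⟨⟨l, hl, m, cls, hsurj⟩, fun B => ⟨fun hlt => ?_, fun heq => ?_⟩⟩
  · by_contra hB
    exact (hcls _ _ (hsnd B hB)).1.not_gt hlt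
  · change cls B.fst = cls B.snd at heq
    change B.left f * l B.snd = B.right f * l B.fst
    by_cases hB : B.left f = 0 ∧ B.right f = 0
    · rw [hB.1, hB.2, zero_mul, zero_mul]
    have hboth : Outranks f B.fst B.snd ∧ Outranks f B.snd B.fst := by
      rcases not_and_or.1 hB with h0 | h0
      · exact ⟨hfst B h0, (hcls _ _ (hfst B h0)).2 heq⟩
      · exact ⟨(hcls _ _ (hsnd B h0)).2 heq.symm, hsnd B h0⟩
    have habs := hint _ _ _ _ hboth.1 hboth.2 ⟨B, rfl, rfl, rfl, rfl⟩
    have hsign := left_mul_right_nonneg h B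
    have h1 := hl B.fst
    have h2 := hl B.snd
    have h3 : |B.left f * l B.snd| = |B.right f * l B.fst| := by
      rw [abs_mul, abs_mul, abs_of_pos h1, abs_of_pos h2, habs]
    -- The walks see absolute values only; the signs agree because the two forces of a bond are
    -- never opposed.
    rcases abs_eq_abs.1 h3 with h4 | h4
    · exact h4
    · have h5 : 0 ≤ (B.left f * l B.snd) * (B.right f * l B.fst) := by
        rw [mul_mul_mul_comm]
        exact mul_nonneg hsign (mul_pos h2 h1).le
      have h6 : B.right f * l B.fst = 0 := by
        rw [h4] at h5
        exact mul_self_eq_zero.1 (le_antisymm (by linarith) (mul_self_nonneg _))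
      rw [h4, h6, neg_zero]

end WelfareSharing

/-! ### From forces to the coefficients of the shares -/

namespace WelfareSharing

variable {N : Type*}

theorem coeff_sub (V W : WelfareFunction N) (T : Finset N) :
    coeff (fun S => V S - W S) T = coeff V T - coeff W T := by
  simp only [coeff, mul_sub, Finset.sum_sub_distrib]

theorem coeff_share_eq_zero (f : DistributionRule N) {i : N} {T : Finset N} (hi : i ∉ T) :
    coeff (f.share i) T = 0 :=
  Finset.sum_eq_zero fun R hR => by
    rw [f.share_eq_zero i R fun h => hi (Finset.mem_powerset.1 hR h), mul_zero]

theorem coeff_distributed (f : DistributionRule N) (T : Finset N) :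
    coeff (distributed f) T = ∑ i ∈ T, coeff (f.share i) T := by
  unfold coeff distributed
  rw [Finset.sum_comm]
  refine Finset.sum_congr rfl fun R hR => ?_
  rw [← Finset.mul_sum]
  congr 1
  exact Finset.sum_subset (Finset.mem_powerset.1 hR) fun i _ hi => f.share_eq_zero i R hi

variable [DecidableEq N]

theorem coeff_insert (W : WelfareFunction N) {T : Finset N} {i : N} (hi : i ∉ T) :
    coeff W (insert i T) = coeff (fun S => W (insert i S)) T - coeff W T := by
  unfold coeff
  rw [Finset.sum_powerset_insert hi, add_comm, sub_eq_add_neg, ← Finset.sum_neg_distrib]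
  refine congrArg₂ _ (Finset.sum_congr rfl fun R hR => ?_) (Finset.sum_congr rfl fun R hR => ?_)
  · have hR' := Finset.mem_powerset.1 hR
    rw [Finset.card_insert_of_notMem hi, Finset.card_insert_of_notMem fun h => hi (hR' h),
      Nat.add_sub_add_right]
  · have := Finset.card_le_card (Finset.mem_powerset.1 hR)
    rw [Finset.card_insert_of_notMem hi, Nat.sub_add_comm this, pow_succ]
    ring

theorem sum_coeff_powerset (W : WelfareFunction N) (S : Finset N) :
    ∑ T ∈ S.powerset, coeff W T = W S := by
  induction S using Finset.induction_on generalizing W with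
  | empty => simp [coeff]
  | insert i S hi ih =>
    rw [Finset.sum_powerset_insert hi, ← Finset.sum_add_distrib, ← ih fun S => W (insert i S)]
    refine Finset.sum_congr rfl fun T hT => ?_
    rw [coeff_insert W fun h => hi (Finset.mem_powerset.1 hT h)]
    ring

variable {𝕎 : Set (WelfareFunction N)}

/-- The share of a player vanishes on coalitions without it, so the Möbius sum pairs up into
differences caused by the other player joining, which are forces. -/
theorem Bond.coeff_share_fst (f : 𝕎 → DistributionRule N) (B : Bond 𝕎) (T : Finset N)
    (h1 : B.fst ∉ T) (h2 : B.snd ∉ T) :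
    coeff ((f B.welfare).share B.fst) (insert B.fst (insert B.snd T)) =
      ∑ S ∈ T.powerset.attach, (-1 : ℝ) ^ (T.card - S.1.card) *
        Bond.left f ⟨B.fst, B.snd, B.ne, B.welfare, S.1,
          fun h => h1 (Finset.mem_powerset.1 S.2 h), fun h => h2 (Finset.mem_powerset.1 S.2 h)⟩ := by
  rw [coeff_insert _ (by simp [B.ne, h1]), coeff_share_eq_zero _ (by simp [B.ne, h1]), sub_zero,
    coeff_insert _ h2, ← coeff_sub]
  exact (Finset.sum_attach _ fun S => (-1 : ℝ) ^ (T.card - S.card) *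
    ((f B.welfare).share B.fst (insert B.fst (insert B.snd S)) -
    (f B.welfare).share B.fst (insert B.fst S))).symm

theorem Bond.coeff_share_snd (f : 𝕎 → DistributionRule N) (B : Bond 𝕎) (T : Finset N)
    (h1 : B.fst ∉ T) (h2 : B.snd ∉ T) :
    coeff ((f B.welfare).share B.snd) (insert B.fst (insert B.snd T)) =
      ∑ S ∈ T.powerset.attach, (-1 : ℝ) ^ (T.card - S.1.card) *
        Bond.right f ⟨B.fst, B.snd, B.ne, B.welfare, S.1,
          fun h => h1 (Finset.mem_powerset.1 S.2 h), fun h => h2 (Finset.mem_powerset.1 S.2 h)⟩ := by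
  rw [Finset.insert_comm]
  refine (B.swap.coeff_share_fst f T h2 h1).trans (Finset.sum_congr rfl fun S _ => ?_)
  congr 1
  exact Bond.left_swap f ⟨B.fst, B.snd, B.ne, B.welfare, S.1, _, _⟩

/-- If the interactions are proportional to the weights, then so are the coefficients of the shares
on every coalition. -/
theorem coeff_share_of_bonds {f : 𝕎 → DistributionRule N} {ω : WeightSystem N}
    (hω : ∀ B : Bond 𝕎, (ω.cls B.fst < ω.cls B.snd → B.right f = 0) ∧
      (ω.cls B.fst = ω.cls B.snd → B.left f * ω.weight B.snd = B.right f * ω.weight B.fst))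
    (W : 𝕎) {T : Finset N} {i j : N} (hi : i ∈ T) (hj : j ∈ T) :
    (ω.cls i < ω.cls j → coeff ((f W).share j) T = 0) ∧
      (ω.cls i = ω.cls j → coeff ((f W).share i) T * ω.weight j =
        coeff ((f W).share j) T * ω.weight i) := by
  by_cases hij : i = j
  · subst hij
    simp
  have hT : insert i (insert j ((T.erase i).erase j)) = T := by
    rw [Finset.insert_erase (Finset.mem_erase.2 ⟨Ne.symm hij, hj⟩), Finset.insert_erase hi]
  let B : Bond 𝕎 := ⟨i, j, hij, W, ∅, by simp, by simp⟩
  have h1 := B.coeff_share_fst f ((T.erase i).erase j) (by simp [B]) (by simp [B])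
  have h2 := B.coeff_share_snd f ((T.erase i).erase j) (by simp [B]) (by simp [B])
  simp only [B, hT] at h1 h2
  rw [h1, h2]
  refine ⟨fun hlt => Finset.sum_eq_zero fun S _ => ?_, fun heq => ?_⟩
  · rw [(hω _).1 hlt, mul_zero]
  · rw [Finset.sum_mul, Finset.sum_mul]
    refine Finset.sum_congr rfl fun S _ => ?_
    rw [mul_assoc, mul_assoc, (hω _).2 heq]

variable [Fintype N]

theorem WeightSystem.mem_top (ω : WeightSystem N) {T : Finset N} {i : N} :
    i ∈ ω.top T ↔ i ∈ T ∧ ∀ j ∈ T, ω.cls i ≤ ω.cls j := by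
  simp [WeightSystem.top]

theorem WeightSystem.sum_weight_top_pos (ω : WeightSystem N) {T : Finset N} (hT : T.Nonempty) :
    0 < ∑ j ∈ ω.top T, ω.weight j := by
  refine Finset.sum_pos (fun j _ => ω.weight_pos j) ?_
  obtain ⟨i, hi, hmin⟩ := T.exists_min_image ω.cls hT
  exact ⟨i, ω.mem_top.2 ⟨hi, hmin⟩⟩

/-- A player `i` is pivotal for `T` exactly when `i ∈ T`, `T ⊆ S` and no member of `T` is removed
for preceding the class of `i`. -/
theorem WeightSystem.inclusion_remaining_sub (ω : WeightSystem N) (S T : Finset N) (i : N) :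
    inclusion T (ω.remaining S (ω.cls i)) - inclusion T ((ω.remaining S (ω.cls i)).erase i) =
      if T ⊆ S ∧ i ∈ ω.top T then 1 else 0 := by
  simp only [inclusion, Finset.subset_erase]
  by_cases hi : i ∈ T
  · have hiff : T ⊆ ω.remaining S (ω.cls i) ↔ T ⊆ S ∧ i ∈ ω.top T := by
      simp only [Finset.subset_iff, ω.mem_remaining, ω.mem_top, hi, true_and]
      exact forall₂_and
    simp [hi, hiff]
  · simp [hi, ω.mem_top]

theorem gwmc_rescale_share (ω : WeightSystem N) (W : WelfareFunction N) (i : N) (S : Finset N) :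
    (gwmc ω (rescale ω W)).share i S = ∑ T ∈ S.powerset,
      if i ∈ ω.top T then ω.weight i * (coeff W T / ∑ j ∈ ω.top T, ω.weight j) else 0 := by
  simp only [gwmc, rescale, Finset.sum_apply, Pi.smul_apply, smul_eq_mul]
  simp only [← Finset.sum_sub_distrib, ← mul_sub, ω.inclusion_remaining_sub]
  rw [Finset.mul_sum, ← Finset.sum_filter]
  symm
  refine Finset.sum_subset_zero_on_sdiff (fun T hT => ?_) (fun T hT => ?_) fun T hT => ?_
  · obtain ⟨-, hi⟩ := Finset.mem_filter.1 hT
    exact Finset.mem_filter.2 ⟨Finset.mem_univ _, i, (ω.mem_top.1 hi).1⟩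
  · have hT' := (Finset.mem_sdiff.1 hT).2
    rw [Finset.mem_filter, Finset.mem_powerset] at hT'
    rw [if_neg hT', mul_zero, mul_zero]
  · rw [Finset.mem_filter, Finset.mem_powerset] at hT
    rw [if_pos hT, mul_one]

theorem eq_gwmc_of_bonds {f : 𝕎 → DistributionRule N} {ω : WeightSystem N}
    (hω : ∀ B : Bond 𝕎, (ω.cls B.fst < ω.cls B.snd → B.right f = 0) ∧
      (ω.cls B.fst = ω.cls B.snd → B.left f * ω.weight B.snd = B.right f * ω.weight B.fst))
    (W : 𝕎) : f W = gwmc ω (rescale ω (distributed (f W))) := by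
  ext i S
  rw [gwmc_rescale_share, ← sum_coeff_powerset ((f W).share i) S]
  refine Finset.sum_congr rfl fun T _ => ?_
  split_ifs with hi
  · obtain ⟨hiT, hmin⟩ := ω.mem_top.1 hi
    have hpos := ω.sum_weight_top_pos ⟨i, hiT⟩
    rw [mul_div_assoc', eq_div_iff hpos.ne', coeff_distributed, Finset.mul_sum, Finset.mul_sum]
    -- Only the top players of `T` have a nonzero coefficient, so the distributed coefficient is a
    -- sum over `ω.top T`.
    rw [← Finset.sum_subset (s₁ := ω.top T) (Finset.filter_subset _ _)]
    · refine Finset.sum_congr rfl fun j hj => ?_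
      obtain ⟨hjT, hjmin⟩ := ω.mem_top.1 hj
      rw [(coeff_share_of_bonds hω W hiT hjT).2 ((hmin j hjT).antisymm (hjmin i hiT)), mul_comm]
    · intro j hjT hj
      have hlt : ω.cls i < ω.cls j := (hmin j hjT).lt_of_not_ge fun hle =>
        hj (ω.mem_top.2 ⟨hjT, fun l hl => hle.trans (hmin l hl)⟩)
      rw [(coeff_share_of_bonds hω W hiT hjT).1 hlt, mul_zero]
  · by_cases hiT : i ∈ T
    · have : ∃ j ∈ T, ω.cls j < ω.cls i := by
        by_contra! hmin
        exact hi (ω.mem_top.2 ⟨hiT, hmin⟩)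
      obtain ⟨j, hjT, hlt⟩ := this
      exact (coeff_share_of_bonds hω W hjT hiT).1 hlt
    · exact coeff_share_eq_zero _ hiT

end WelfareSharing

theorem theorem2 {N : Type*} [Fintype N] [DecidableEq N]
    (𝕎 : Set (WelfareSharing.WelfareFunction N))
    (f : 𝕎 → WelfareSharing.DistributionRule N) :
    (∀ G : WelfareSharing.WelfareGame 𝕎, ∃ a : N → Finset G.Resource, G.IsPureNash f a) ↔
      ∃ (ω : WelfareSharing.WeightSystem N) (gMC : 𝕎 → WelfareSharing.WelfareFunction N),
        (∀ W : 𝕎, gMC W = WelfareSharing.rescale ω (WelfareSharing.distributed (f W))) ∧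
          ∀ W : 𝕎, f W = WelfareSharing.gwmc ω (gMC W) := by
  constructor
  · intro h
    obtain ⟨ω, hω⟩ := WelfareSharing.exists_weightSystem h
    exact ⟨ω, _, fun _ => rfl, WelfareSharing.eq_gwmc_of_bonds hω⟩
  · rintro ⟨ω, gMC, -, hf⟩ G
    obtain rfl : f = fun W => WelfareSharing.gwmc ω (gMC W) := funext hf
    exact G.exists_isPureNash_gwmc ω gMC
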